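/- Let $X \subset \mathbf{R}^n$ be a bounded, open, convex set. For a nonnegative convex function $u : X \to \mathbf{R}$ put $$\Phi[u] := \int_{X} \Big( \tfrac12 |Du|^2 + u - x\cdot Du \Big)\, dx \in (-\infty, +\infty],$$ where $Du$ is the gradient of $u$, which exists almost everywhere in $X$; the integrand is bounded below by the integrable function $-\tfrac12|x|^2$, and $\Phi[u] = +\infty$ when the integrand is not integrable. Let $u$ minimize $\Phi$ over the set of all nonnegative convex functions on $X$. Then $u \in C^{1,1}_{\mathrm{loc}}(X)$; that is, $u$ is continuously differentiable on $X$, and $u$ and $Du$ are Lipschitz on every compact subset of $X$. -/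

import Mathlib

open MeasureTheory
open scoped NNReal

namespace PrincipalAgent

/-- The integrand `½|Du(x)|² + u(x) - x · Du(x)`. A convex function on an open set is locally
Lipschitz, hence differentiable almost everywhere, and its almost everywhere defined gradient `Du`
is also its weak gradient. -/
noncomputable def integrand {n : ℕ} (u : EuclideanSpace ℝ (Fin n) → ℝ)
    (x : EuclideanSpace ℝ (Fin n)) : ℝ :=
  1 / 2 * ‖gradient u x‖ ^ 2 + u x - inner ℝ x (gradient u x)

/-- Completing the square in the integrand. -/
theorem integrand_eq {n : ℕ} (u : EuclideanSpace ℝ (Fin n) → ℝ)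
    (x : EuclideanSpace ℝ (Fin n)) :
    integrand u x = 1 / 2 * ‖gradient u x - x‖ ^ 2 + u x - 1 / 2 * ‖x‖ ^ 2 := by
  rw [integrand, norm_sub_sq_real, real_inner_comm]
  ring

/-- The integrand is bounded below on bounded sets where `u` is nonnegative. -/
theorem neg_half_sq_le_integrand {n : ℕ} {u : EuclideanSpace ℝ (Fin n) → ℝ}
    {x : EuclideanSpace ℝ (Fin n)} (hu : 0 ≤ u x) :
    -(1 / 2 * ‖x‖ ^ 2) ≤ integrand u x := by
  rw [integrand_eq]
  have h : 0 ≤ 1 / 2 * ‖gradient u x - x‖ ^ 2 := by positivity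
  linarith

open Classical in
/-- The functional `Φ[u] = ∫_X (½|Du|² + u - x · Du) dx`, with values in `(-∞, +∞]`. For `X`
bounded and open and `u` nonnegative and convex on `X`, the integrand is measurable on `X` and is
bounded below on `X` by a constant, so that its integral is `+∞` as soon as it is not integrable. -/
noncomputable def Phi {n : ℕ} (X : Set (EuclideanSpace ℝ (Fin n)))
    (u : EuclideanSpace ℝ (Fin n) → ℝ) : EReal :=
  if IntegrableOn (integrand u) X volume then ((∫ x in X, integrand u x : ℝ) : EReal) else ⊤

/-- The admissible class: nonnegative convex functions on `X`. Only the values on `X` matter. -/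
def admissible {n : ℕ} (X : Set (EuclideanSpace ℝ (Fin n))) :
    Set (EuclideanSpace ℝ (Fin n) → ℝ) :=
  {u | ConvexOn ℝ X u ∧ ∀ x ∈ X, 0 ≤ u x}

/-- `u` minimizes `Φ` over the admissible class. -/
def IsMinimizer {n : ℕ} (X : Set (EuclideanSpace ℝ (Fin n)))
    (u : EuclideanSpace ℝ (Fin n) → ℝ) : Prop :=
  u ∈ admissible X ∧ ∀ v ∈ admissible X, Phi X u ≤ Phi X v

/-- `u ∈ C^{1,1}_loc(X)` for `X` open: `u` is continuously differentiable on `X`, and `u` and its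
gradient are Lipschitz on every compact subset of `X`. -/
def IsC11Loc {n : ℕ} (X : Set (EuclideanSpace ℝ (Fin n)))
    (u : EuclideanSpace ℝ (Fin n) → ℝ) : Prop :=
  ContDiffOn ℝ 1 u X ∧
    ∀ K : Set (EuclideanSpace ℝ (Fin n)), IsCompact K → K ⊆ X →
      (∃ L : ℝ≥0, LipschitzOnWith L u K) ∧ (∃ L : ℝ≥0, LipschitzOnWith L (gradient u) K)

end PrincipalAgent

namespace PrincipalAgent

open Set Filter Topology

/-! ### Convex and concave functions: subgradients, tangent planes, differentiability. -/

section Convex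

variable {E : Type*} [NormedAddCommGroup E] [InnerProductSpace ℝ E] {X : Set E} {u w : E → ℝ}

/-! It suffices to bound the height of `u` over each supporting affine function by a multiple of the
squared distance to the contact point, uniformly on compact sets (`exists_quadratic_bound`): every
subgradient is then the gradient, and the gradient is locally Lipschitz.

For the quadratic bound (`height_le`), let the height over a ball about `x₀` have its maximum `H` at
`x₁`, with `r = ‖x₁ - x₀‖`. Add `H/2 * (1 + s)` to the support, where `s` is the affine coordinate
with `s x₀ = 0` and `s x₁ = 1` along `e = x₁ - x₀`. Let `w` be the tilted function minus `u`, and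
`S` the set where `w > 0`. Convexity and maximality confine `S` to the slab `-1 < s ≤ 1`, of width
`2r`, and `w ≤ H`.

The maximum of `u` and the tilted function is admissible, so minimality bounds the Dirichlet energy
of `w` on `S` by first-order terms, and these are at most `A * H * |S|` (`energy_le`). As `S` may
reach the boundary of `X`, integration by parts is replaced by contracting `S` towards a point of
`X`. Conversely, `w ≥ H/4` on a half-size copy of `S`, and translation by `2e` carries this copy out
of `S`; hence `H * |S|` is at most a constant times `r` times the integral of `‖Dw‖` over `S`.
Together these give `H ≤ C * r ^ 2`. -/

theorem concaveOn_le_slope (hw : ConcaveOn ℝ X w) {x y : E} (hx : x ∈ X) (hy : y ∈ X) {t : ℝ}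
    (ht : 0 < t) (ht1 : t ≤ 1) : w y - w x ≤ (w (x + t • (y - x)) - w x) / t := by
  rw [le_div_iff₀ ht]
  have h := hw.2 hx hy (sub_nonneg.2 ht1) ht.le (sub_add_cancel 1 t)
  have e : (1 - t) • x + t • y = x + t • (y - x) := by module
  rw [e, smul_eq_mul, smul_eq_mul] at h
  linarith

variable [FiniteDimensional ℝ E]

/-- A convex function on an open set has a subgradient at every point. -/
theorem exists_subgradient (hX : IsOpen X) (hu : ConvexOn ℝ X u) {x₀ : E} (hx₀ : x₀ ∈ X) :
    ∃ g : E, ∀ x ∈ X, u x₀ + inner ℝ g (x - x₀) ≤ u x := by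
  have hc : ContinuousOn u X := hu.continuousOn hX
  have hopen : IsOpen {p : E × ℝ | p.1 ∈ X ∧ u p.1 < p.2} := by
    have h1 : IsOpen (X ×ˢ (univ : Set ℝ)) := hX.prod isOpen_univ
    have h2 : ContinuousOn (fun p : E × ℝ => p.2 - u p.1) (X ×ˢ (univ : Set ℝ)) :=
      continuousOn_snd.sub (hc.comp continuousOn_fst fun p hp => hp.1)
    have h3 := h2.isOpen_inter_preimage h1 isOpen_Ioi (t := Ioi (0 : ℝ))
    convert h3 using 1
    ext p
    simp
  obtain ⟨f, hf⟩ := geometric_hahn_banach_point_open hu.convex_strict_epigraph hopen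
    (x := (x₀, u x₀)) (by simp)
  have hsplit : ∀ x t, f (x, t) = f (x, 0) + t * f (0, 1) := by
    intro x t
    have : ((x, t) : E × ℝ) = (x, 0) + t • ((0, 1) : E × ℝ) := by simp
    rw [this, map_add, map_smul, smul_eq_mul]
  -- The strict epigraph contains a point directly above `x₀`, so the separating hyperplane is not
  -- vertical.
  have hpos : 0 < f (0, 1) := by
    have := hf (x₀, u x₀ + 1) ⟨hx₀, by simp⟩
    rw [hsplit x₀ (u x₀), hsplit x₀ (u x₀ + 1)] at this
    linarith
  set c := f (0, 1)
  let G : StrongDual ℝ E := f.comp (ContinuousLinearMap.inl ℝ E ℝ)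
  have hG : ∀ x, G x = f (x, 0) := fun x => rfl
  refine ⟨-(c⁻¹ • (InnerProductSpace.toDual ℝ E).symm G), fun x hx => ?_⟩
  rw [inner_neg_left, real_inner_smul_left, InnerProductSpace.toDual_symm_apply, map_sub, hG, hG]
  have hle : f (x₀, 0) + u x₀ * c ≤ f (x, 0) + u x * c := by
    refine le_of_forall_pos_le_add fun ε hε => ?_
    have := hf (x, u x + ε / c) ⟨hx, by have : 0 < ε / c := by positivity
                                        simpa using this⟩
    rw [hsplit x₀ (u x₀), hsplit x (u x + ε / c), add_mul, div_mul_cancel₀ _ hpos.ne'] at this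
    linarith
  have : u x - u x₀ + c⁻¹ * (f (x, 0) - f (x₀, 0))
      = c⁻¹ * ((f (x, 0) + u x * c) - (f (x₀, 0) + u x₀ * c)) := by
    field_simp
    ring
  have h0 : 0 ≤ c⁻¹ * ((f (x, 0) + u x * c) - (f (x₀, 0) + u x₀ * c)) :=
    mul_nonneg (by positivity) (by linarith)
  linarith

theorem tendsto_slope_gradient {x : E} (hd : DifferentiableAt ℝ w x) (v : E) :
    Tendsto (fun t : ℝ => (w (x + t • v) - w x) / t) (𝓝[>] 0) (𝓝 (inner ℝ (gradient w x) v)) := by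
  have h := (hd.hasFDerivAt.hasLineDerivAt v).tendsto_slope_zero_right
  rw [← inner_gradient_left] at h
  refine h.congr fun t => ?_
  rw [smul_eq_mul, div_eq_inv_mul]

/-- A concave function lies below its tangent planes. -/
theorem concaveOn_sub_le_inner_gradient (hw : ConcaveOn ℝ X w) {x y : E} (hx : x ∈ X) (hy : y ∈ X)
    (hd : DifferentiableAt ℝ w x) : w y - w x ≤ inner ℝ (gradient w x) (y - x) := by
  refine ge_of_tendsto (tendsto_slope_gradient hd (y - x)) ?_
  have : Ioc (0 : ℝ) 1 ∈ 𝓝[>] (0 : ℝ) := Ioc_mem_nhdsGT one_pos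
  filter_upwards [this] with t ht
  exact concaveOn_le_slope hw hx hy ht.1 ht.2

theorem isOpen_setOf_pos (hX : IsOpen X) (hw : ConcaveOn ℝ X w) : IsOpen {x ∈ X | 0 < w x} :=
  (hw.continuousOn hX).isOpen_inter_preimage hX isOpen_Ioi (t := Ioi (0 : ℝ))

variable [MeasurableSpace E] [BorelSpace E] {μ : Measure E} [μ.IsAddHaarMeasure]

/-- A locally Lipschitz function on an open set is differentiable almost everywhere in it. -/
theorem ae_differentiableAt_of_locallyLipschitzOn (hX : IsOpen X) (hu : LocallyLipschitzOn X u) :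
    ∀ᵐ x ∂μ, x ∈ X → DifferentiableAt ℝ u x := by
  rw [ae_iff]
  refine measure_null_of_locally_null _ fun x hx => ?_
  have hxX : x ∈ X := by_contra fun h => hx fun h' => absurd h' h
  obtain ⟨K, t, ht, hL⟩ := hu hxX
  rw [hX.nhdsWithin_eq hxX] at ht
  obtain ⟨s, hst, hs, hxs⟩ := mem_nhds_iff.1 (inter_mem ht (hX.mem_nhds hxX))
  have hLs : LipschitzOnWith K u s := hL.mono fun y hy => (hst hy).1
  have hae := hLs.ae_differentiableWithinAt_of_mem (μ := μ)
  refine ⟨_, inter_mem_nhdsWithin _ (hs.mem_nhds hxs), measure_mono_null ?_ (ae_iff.1 hae)⟩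
  rintro y ⟨hy, hys⟩
  simp only [mem_ofPred_eq, Classical.not_imp] at hy ⊢
  exact ⟨hys, fun h => hy.2 (h.differentiableAt (hs.mem_nhds hys))⟩

theorem convexOn_ae_differentiableAt (hX : IsOpen X) (hu : ConvexOn ℝ X u) :
    ∀ᵐ x ∂μ, x ∈ X → DifferentiableAt ℝ u x :=
  ae_differentiableAt_of_locallyLipschitzOn hX (hu.locallyLipschitzOn hX)

theorem concaveOn_ae_differentiableAt (hX : IsOpen X) (hw : ConcaveOn ℝ X w) :
    ∀ᵐ x ∂μ, x ∈ X → DifferentiableAt ℝ w x :=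
  ae_differentiableAt_of_locallyLipschitzOn hX (hw.locallyLipschitzOn hX)

theorem measurable_gradient (f : E → ℝ) : Measurable (gradient f) :=
  (InnerProductSpace.toDual ℝ E).symm.continuous.measurable.comp (measurable_fderiv ℝ f)

end Convex

/-! ### Two integral inequalities for a concave function on its positivity set. -/

section Integral

variable {E : Type*} [NormedAddCommGroup E] [InnerProductSpace ℝ E] [FiniteDimensional ℝ E]
  [MeasurableSpace E] [BorelSpace E] {μ : Measure E} [μ.IsAddHaarMeasure] {X : Set E} {w : E → ℝ}

theorem integrableOn_of_mem_Icc {S : Set E} (hS : MeasurableSet S) (hSb : Bornology.IsBounded S)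
    {a b : ℝ} (hw : ContinuousOn w S) (h : ∀ x ∈ S, w x ∈ Icc a b) : IntegrableOn w S μ := by
  refine IntegrableOn.of_bound hSb.measure_lt_top (hw.aestronglyMeasurable hS) (max |a| |b|) ?_
  filter_upwards [ae_restrict_mem hS] with x hx
  exact abs_le_max_abs_abs (h x hx).1 (h x hx).2

/-- The integral of the positive part of a concave function decreases under contractions of the
domain towards one of its points, in infinitesimal form. -/
theorem setIntegral_inner_gradient_le (hX : IsOpen X) (hXb : Bornology.IsBounded X)
    (hw : ConcaveOn ℝ X w) {H : ℝ} (hH : ∀ x ∈ X, w x ≤ H) {c : E} (hc : c ∈ X)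
    (hint : IntegrableOn (fun x => inner ℝ (gradient w x) (c - x)) {x ∈ X | 0 < w x} μ) :
    ∫ x in {x ∈ X | 0 < w x}, inner ℝ (gradient w x) (c - x) ∂μ ≤
      Module.finrank ℝ E * ∫ x in {x ∈ X | 0 < w x}, w x ∂μ := by
  set S := {x ∈ X | 0 < w x} with hSdef
  have hSX : S ⊆ X := fun x hx => hx.1
  have hSo : IsOpen S := isOpen_setOf_pos hX hw
  have hSm := hSo.measurableSet
  have hSb := hXb.subset hSX
  have hwc : ContinuousOn w X := hw.continuousOn hX
  have hwint : IntegrableOn w S μ :=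
    integrableOn_of_mem_Icc hSm hSb (hwc.mono hSX) fun x hx => ⟨hx.2.le, hH x hx.1⟩
  have hmem : ∀ t ∈ Ioo (0 : ℝ) 1, ∀ x ∈ X, x + t • (c - x) ∈ X := fun t ht x hx =>
    hw.1.add_smul_sub_mem hx hc ⟨ht.1.le, ht.2.le⟩
  set d := Module.finrank ℝ E
  -- This bounds the difference quotients below uniformly; the tangent plane bounds them above.
  -- Dominated convergence needs both.
  have hlow : ∀ t ∈ Ioo (0 : ℝ) 1, ∀ x ∈ S, w c - H ≤ (w (x + t • (c - x)) - w x) / t :=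
    fun t ht x hx => (sub_le_sub_left (hH x hx.1) _).trans
      (concaveOn_le_slope hw hx.1 hc ht.1 ht.2.le)
  have hcomp : ∀ t ∈ Ioo (0 : ℝ) 1, ContinuousOn (fun x => w (x + t • (c - x))) S := fun t ht =>
    hwc.comp (by fun_prop) fun x hx => hmem t ht x hx.1
  have hI : ∀ t ∈ Ioo (0 : ℝ) 1, ∫ x in S, (w (x + t • (c - x)) - w x) / t ∂μ ≤
      ((((1 - t) ^ d)⁻¹ - 1) / t) * ∫ x in S, w x ∂μ := by
    intro t ht
    have h1t : 0 < 1 - t := by linarith [ht.2]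
    have hfint : IntegrableOn (fun x => w (x + t • (c - x))) S μ := by
      refine integrableOn_of_mem_Icc hSm hSb (hcomp t ht) (a := -(|w c - H|)) (b := H)
        fun x hx => ⟨?_, hH _ (hmem t ht x hx.1)⟩
      have h1 := hlow t ht x hx
      rw [le_div_iff₀ ht.1] at h1
      have h2 : -|w c - H| ≤ (w c - H) * t := by
        have := neg_abs_le (w c - H)
        have h3 : |w c - H| * t ≤ |w c - H| := mul_le_of_le_one_right (abs_nonneg _) ht.2.le
        nlinarith [ht.1]
      linarith [hx.2]
    have hWint : Integrable (S.indicator w) μ := (integrable_indicator_iff hSm).2 hwint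
    have e1 : ∀ x, S.indicator w (x + t • (c - x))
        = (fun y => S.indicator w (y + t • c)) ((1 - t) • x) := by
      intro x
      congr 1
      module
    have hWcint : Integrable (fun x => S.indicator w (x + t • (c - x))) μ := by
      simp_rw [e1]
      exact (hWint.comp_add_right (t • c)).comp_smul h1t.ne'
    have e2 : ∫ x, S.indicator w (x + t • (c - x)) ∂μ = ((1 - t) ^ d)⁻¹ * ∫ x in S, w x ∂μ := by
      simp_rw [e1]
      rw [Measure.integral_comp_smul_of_nonneg μ (fun y => S.indicator w (y + t • c)) (1 - t)
        (hR := h1t.le), integral_add_right_eq_self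
        (fun y => S.indicator w y), integral_indicator hSm, smul_eq_mul]
    have hW0 : ∀ x, 0 ≤ S.indicator w x := indicator_nonneg fun x hx => hx.2.le
    have e3 : ∫ x in S, w (x + t • (c - x)) ∂μ ≤ ((1 - t) ^ d)⁻¹ * ∫ x in S, w x ∂μ := by
      rw [← e2]
      refine le_trans (setIntegral_mono_on hfint hWcint.integrableOn hSm fun x hx => ?_)
        (setIntegral_le_integral hWcint (ae_of_all _ fun x => hW0 _))
      by_cases h : x + t • (c - x) ∈ S
      · rw [indicator_of_mem h]
      · rw [indicator_of_notMem h]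
        exact not_lt.1 fun h' => h ⟨hmem t ht x hx.1, h'⟩
    rw [integral_div, integral_sub hfint hwint, div_mul_eq_mul_div]
    refine div_le_div_of_nonneg_right ?_ ht.1.le
    linarith
  have hev : Ioo (0 : ℝ) 1 ∈ 𝓝[>] (0 : ℝ) := Ioo_mem_nhdsGT one_pos
  have hdiff : ∀ᵐ x ∂(μ.restrict S), DifferentiableAt ℝ w x := by
    filter_upwards [ae_restrict_mem hSm, ae_restrict_of_ae (concaveOn_ae_differentiableAt hX hw)]
      with x hx h using h hx.1
  have hlim : Tendsto (fun t : ℝ => ∫ x in S, (w (x + t • (c - x)) - w x) / t ∂μ) (𝓝[>] 0)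
      (𝓝 (∫ x in S, inner ℝ (gradient w x) (c - x) ∂μ)) := by
    refine tendsto_integral_filter_of_dominated_convergence
      (fun x => |w c - H| + |inner ℝ (gradient w x) (c - x)|) ?_ ?_ ?_ ?_
    · filter_upwards [hev] with t ht
      exact (((hcomp t ht).sub (hwc.mono hSX)).div_const t).aestronglyMeasurable hSm
    · filter_upwards [hev] with t ht
      filter_upwards [ae_restrict_mem hSm, hdiff] with x hx hd
      have h1 := hlow t ht x hx
      have h2 : (w (x + t • (c - x)) - w x) / t ≤ inner ℝ (gradient w x) (c - x) := by
        rw [div_le_iff₀ ht.1]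
        have := concaveOn_sub_le_inner_gradient hw hx.1 (hmem t ht x hx.1) hd
        rwa [add_sub_cancel_left, real_inner_smul_right, mul_comm] at this
      rw [Real.norm_eq_abs, abs_le]
      constructor
      · linarith [neg_abs_le (w c - H), abs_nonneg (inner ℝ (gradient w x) (c - x) : ℝ)]
      · linarith [le_abs_self (inner ℝ (gradient w x) (c - x) : ℝ), abs_nonneg (w c - H)]
    · exact (integrable_const_iff.2 (Or.inr ⟨by
        simpa using hSb.measure_lt_top⟩)).add hint.abs
    · filter_upwards [hdiff] with x hd using tendsto_slope_gradient hd (c - x)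
  -- The dimension enters as the derivative at `t = 0` of the Jacobian factor.
  have hder : Tendsto (fun t : ℝ => (((1 - t) ^ d)⁻¹ - 1) / t) (𝓝[>] 0) (𝓝 d) := by
    have h1 : HasDerivAt (fun t : ℝ => ((1 - t) ^ d)⁻¹) d 0 := by
      have h2 : HasDerivAt (fun t : ℝ => (1 - t) ^ d) (-(d : ℝ)) 0 := by
        have := ((hasDerivAt_id (0 : ℝ)).const_sub 1).fun_pow d
        simpa using this
      simpa using h2.fun_inv (by simp)
    have h3 := h1.tendsto_slope_zero_right
    refine h3.congr fun t => ?_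
    simp [div_eq_inv_mul]
  exact le_of_tendsto_of_tendsto hlim (hder.mul_const _)
    (by filter_upwards [hev] with t ht using hI t ht)

/-- If translation by `e` moves the part `S'` of the positivity set `S` of a concave function out
of `S`, then the total variation of the function in the direction of `e` is bounded below. -/
theorem mul_measureReal_le_setIntegral_abs_inner_gradient (hX : IsOpen X)
    (hXb : Bornology.IsBounded X) (hw : ConcaveOn ℝ X w) {S' K : Set E} {e : E} {a : ℝ}
    (hK : IsCompact K) (hKX : K ⊆ X) (hS'm : MeasurableSet S') (hS' : S' ⊆ {x ∈ X | 0 < w x})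
    (hS'K : ∀ x ∈ S', ∀ t ∈ Icc (0 : ℝ) 1, x + t • e ∈ K)
    (hexit : ∀ x ∈ S', ¬ 0 < w (x + e)) (ha : ∀ x ∈ S', a ≤ w x)
    (hint : IntegrableOn (fun x => inner ℝ (gradient w x) e) {x ∈ X | 0 < w x} μ) :
    a * μ.real S' ≤ ∫ x in {x ∈ X | 0 < w x}, |inner ℝ (gradient w x) e| ∂μ := by
  set S := {x ∈ X | 0 < w x} with hSdef
  have hSX : S ⊆ X := fun x hx => hx.1
  have hSo : IsOpen S := isOpen_setOf_pos hX hw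
  have hSm := hSo.measurableSet
  have hwc : ContinuousOn w X := hw.continuousOn hX
  have hSconv : Convex ℝ S := hw.convex_gt 0
  have hS'fin : μ S' < ⊤ := (hXb.subset (hS'.trans hSX)).measure_lt_top
  set G : E → ℝ := S.indicator fun x => |inner ℝ (gradient w x) e| with hG
  have hG0 : ∀ x, 0 ≤ G x := indicator_nonneg fun x _ => abs_nonneg _
  have hGint : Integrable G μ := (integrable_indicator_iff hSm).2 hint.abs
  rw [← integral_indicator hSm]
  refine le_of_forall_pos_le_add fun ε₀ hε₀ => ?_
  obtain ⟨ε, hε, hεle⟩ : ∃ ε > 0, ε * μ.real S' ≤ ε₀ := by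
    refine ⟨ε₀ / (μ.real S' + 1), by positivity, ?_⟩
    rw [div_mul_eq_mul_div, div_le_iff₀ (by positivity)]
    nlinarith [measureReal_nonneg (μ := μ) (s := S')]
  -- The segment from `x` to `x + e` is cut into `N` steps so short that `w` changes by less than
  -- `ε` in each. Tangent-plane inequalities at the nodes then replace the fundamental theorem of
  -- calculus along lines.
  have huc := hK.uniformContinuousOn_of_continuous (hwc.mono hKX)
  rw [Metric.uniformContinuousOn_iff] at huc
  obtain ⟨η, hη, hηK⟩ := huc ε hε
  obtain ⟨N, hN⟩ := exists_nat_gt (‖e‖ / η)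
  have hN0 : (0 : ℝ) < N := lt_of_le_of_lt (by positivity) hN
  set τ : ℝ := 1 / N with hτ
  have hτ0 : 0 < τ := by positivity
  have hτN : N * τ = 1 := by rw [hτ]; field_simp
  have hτe : τ * ‖e‖ < η := by
    rw [hτ, one_div_mul_eq_div, div_lt_iff₀ hN0]
    rwa [div_lt_iff₀ hη, mul_comm] at hN
  -- Translations preserve null sets, so almost every `x` has all its nodes in `X` at points of
  -- differentiability.
  have hae : ∀ᵐ x ∂μ, ∀ k : ℕ, x + (k * τ) • e ∈ X → DifferentiableAt ℝ w (x + (k * τ) • e) := by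
    rw [ae_all_iff]
    intro k
    exact (measurePreserving_add_right μ ((k * τ) • e)).quasiMeasurePreserving.ae
      (concaveOn_ae_differentiableAt hX hw)
  have hpt : ∀ᵐ x ∂(μ.restrict S'),
      a ≤ ε + ∑ k ∈ Finset.range N, τ * G (x + ((k + 1 : ℕ) * τ) • e) := by
    filter_upwards [ae_restrict_mem hS'm, ae_restrict_of_ae hae] with x hx hd
    have hKk : ∀ k : ℕ, k ≤ N → x + (k * τ) • e ∈ K := fun k hk =>
      hS'K x hx _ ⟨by positivity, by
        rw [← hτN]; exact mul_le_mul_of_nonneg_right (by exact_mod_cast hk) hτ0.le⟩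
    have hex : ∃ k : ℕ, x + (k * τ) • e ∉ S := ⟨N, fun h => hexit x hx (by
      rw [hτN, one_smul] at h; exact h.2)⟩
    classical
    -- `m` is the first node outside `S`. At the preceding node `j`, `w` is already at most `ε`.
    set m := Nat.find hex with hm
    have hmN : m ≤ N := Nat.find_min' hex fun h => hexit x hx (by
      rw [hτN, one_smul] at h; exact h.2)
    have hmS : x + (m * τ) • e ∉ S := Nat.find_spec hex
    have hlt : ∀ k < m, x + (k * τ) • e ∈ S := fun k hk => not_not.1 (Nat.find_min hex hk)
    have hm0 : m ≠ 0 := fun h => hmS (by rw [h]; simpa using hS' hx)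
    obtain ⟨j, hj⟩ := Nat.exists_eq_succ_of_ne_zero hm0
    have hstep : ∀ k, k ≤ j → w x ≤ w (x + (k * τ) • e)
        + ∑ i ∈ Finset.range k, τ * G (x + ((i + 1 : ℕ) * τ) • e) := by
      intro k
      induction k with
      | zero => intro _; simp
      | succ k ih =>
        intro hk
        have h1 := ih (by omega)
        rw [Finset.sum_range_succ]
        have hz := hlt (k + 1) (by omega)
        have hp := hlt k (by omega)
        have h2 := concaveOn_sub_le_inner_gradient hw hz.1 hp.1 (hd (k + 1) hz.1)
        have h3 : x + ((k : ℝ) * τ) • e - (x + (((k + 1 : ℕ) : ℝ) * τ) • e) = (-τ) • e := by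
          push_cast
          module
        rw [h3, real_inner_smul_right] at h2
        have h4 : G (x + ((k + 1 : ℕ) * τ) • e)
            = |inner ℝ (gradient w (x + ((k + 1 : ℕ) * τ) • e)) e| := indicator_of_mem hz _
        rw [h4]
        have h5 := mul_le_mul_of_nonneg_left
          (neg_abs_le (inner ℝ (gradient w (x + ((k + 1 : ℕ) * τ) • e)) e)) hτ0.le
        linarith
    have h1 := hstep j le_rfl
    have h2 : w (x + ((j : ℝ) * τ) • e) ≤ ε := by
      have hKj := hKk j (by omega)
      have hKm := hKk m hmN
      have hdist : dist (x + ((j : ℝ) * τ) • e) (x + ((m : ℝ) * τ) • e) < η := by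
        rw [dist_eq_norm, hj]
        have : x + ((j : ℝ) * τ) • e - (x + (((j + 1 : ℕ) : ℝ) * τ) • e) = (-τ) • e := by
          push_cast
          module
        rw [Nat.succ_eq_add_one, this, norm_smul, norm_neg, Real.norm_of_nonneg hτ0.le]
        exact hτe
      have h3 := hηK _ hKj _ hKm hdist
      rw [Real.dist_eq] at h3
      have h4 : w (x + ((m : ℝ) * τ) • e) ≤ 0 := not_lt.1 fun h => hmS ⟨hKX hKm, h⟩
      linarith [(abs_lt.1 h3).2]
    have h3 : ∑ i ∈ Finset.range j, τ * G (x + ((i + 1 : ℕ) * τ) • e)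
        ≤ ∑ i ∈ Finset.range N, τ * G (x + ((i + 1 : ℕ) * τ) • e) :=
      Finset.sum_le_sum_of_subset_of_nonneg (Finset.range_mono (by omega))
        fun i _ _ => mul_nonneg hτ0.le (hG0 _)
    linarith [ha x hx]
  have hGk : ∀ v, Integrable (fun x => G (x + v)) μ := fun v => hGint.comp_add_right v
  have hGle : ∀ v, ∫ x in S', G (x + v) ∂μ ≤ ∫ x, G x ∂μ := fun v =>
    (setIntegral_le_integral (hGk v) (ae_of_all _ fun x => hG0 _)).trans_eq
      (integral_add_right_eq_self G v)
  have hconst : ∀ b : ℝ, IntegrableOn (fun _ : E => b) S' μ := fun b =>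
    integrableOn_const hS'fin.ne
  have hsumint : Integrable (fun x => ∑ k ∈ Finset.range N, τ * G (x + ((k + 1 : ℕ) * τ) • e))
      (μ.restrict S') :=
    integrable_finsetSum _ fun k _ => ((hGk _).integrableOn).const_mul τ
  have hfin := integral_mono_ae (hconst a) ((hconst ε).add hsumint) hpt
  simp only [Pi.add_apply] at hfin
  rw [integral_add (hconst ε) hsumint, integral_finsetSum _ fun k _ =>
    ((hGk _).integrableOn).const_mul τ, setIntegral_const, setIntegral_const] at hfin
  simp only [smul_eq_mul, integral_const_mul] at hfin
  have hsum : ∑ k ∈ Finset.range N, τ * ∫ x in S', G (x + ((k + 1 : ℕ) * τ) • e) ∂μ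
      ≤ ∫ x, G x ∂μ := by
    calc _ ≤ ∑ k ∈ Finset.range N, τ * ∫ x, G x ∂μ :=
          Finset.sum_le_sum fun k _ => mul_le_mul_of_nonneg_left (hGle _) hτ0.le
      _ = _ := by rw [Finset.sum_const, Finset.card_range, nsmul_eq_mul, ← mul_assoc, hτN, one_mul]
  linarith

end Integral

/-! ### Energy estimates from minimality. -/

section Energy

variable {n : ℕ} {X : Set (EuclideanSpace ℝ (Fin n))} {u : EuclideanSpace ℝ (Fin n) → ℝ}

theorem hasGradientAt_affine (b : ℝ) (g x : EuclideanSpace ℝ (Fin n)) :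
    HasGradientAt (fun x => b + inner ℝ g x) g x := by
  rw [hasGradientAt_iff_hasFDerivAt]
  exact ((InnerProductSpace.toDual ℝ _ g).hasFDerivAt).const_add b

theorem hasGradientAt_affine_sub (b : ℝ) (g : EuclideanSpace ℝ (Fin n))
    {x : EuclideanSpace ℝ (Fin n)} (hd : DifferentiableAt ℝ u x) :
    HasGradientAt (fun x => b + inner ℝ g x - u x) (g - gradient u x) x := by
  rw [hasGradientAt_iff_hasFDerivAt, map_sub]
  exact (hasGradientAt_affine b g x).hasFDerivAt.sub hd.hasGradientAt.hasFDerivAt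

theorem convexOn_affine (hX : Convex ℝ X) (b : ℝ) (g : EuclideanSpace ℝ (Fin n)) :
    ConvexOn ℝ X fun x => b + inner ℝ g x :=
  (convexOn_const b hX).add ((InnerProductSpace.toDual ℝ _ g).toLinearMap.convexOn hX)

theorem concaveOn_affine_sub (hu : ConvexOn ℝ X u) (b : ℝ) (g : EuclideanSpace ℝ (Fin n)) :
    ConcaveOn ℝ X fun x => b + inner ℝ g x - u x :=
  ((concaveOn_const b hu.1).add ((InnerProductSpace.toDual ℝ _ g).toLinearMap.concaveOn hu.1)).sub hu

/-- The zero function is an admissible competitor with finite energy. -/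
theorem IsMinimizer.integrableOn_integrand (hu : IsMinimizer X u) :
    IntegrableOn (integrand u) X volume := by
  by_contra h
  have h0 : (fun _ => 0 : EuclideanSpace ℝ (Fin n) → ℝ) ∈ admissible X :=
    ⟨convexOn_const 0 hu.1.1.1, fun _ _ => le_rfl⟩
  have hz : integrand (fun _ => 0 : EuclideanSpace ℝ (Fin n) → ℝ) = fun _ => 0 := by
    funext x
    simp [integrand]
  have hle := hu.2 _ h0
  rw [Phi, if_neg h, Phi, hz, if_pos integrableOn_zero] at hle
  simp at hle

theorem IsMinimizer.integrableOn_norm_gradient_sub_sq (hXo : IsOpen X)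
    (hXb : Bornology.IsBounded X) (hu : IsMinimizer X u) (a : EuclideanSpace ℝ (Fin n)) :
    IntegrableOn (fun x => ‖a - gradient u x‖ ^ 2) X volume := by
  have hcont : ∀ f : EuclideanSpace ℝ (Fin n) → ℝ, Continuous f → IntegrableOn f X volume :=
    fun f hf => ((hf.locallyIntegrable).integrableOn_isCompact
      hXb.isCompact_closure).mono_set subset_closure
  have h1 : IntegrableOn (fun x => 4 * integrand u x + (2 * ‖x‖ ^ 2 + 2 * ‖a - x‖ ^ 2)) X volume :=
    (hu.integrableOn_integrand.const_mul 4).add (hcont _ (by fun_prop))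
  refine h1.mono' (((measurable_const.sub (measurable_gradient u)).norm.pow_const
    2).aestronglyMeasurable) ?_
  filter_upwards [ae_restrict_mem hXo.measurableSet] with x hx
  rw [Real.norm_of_nonneg (by positivity), integrand_eq]
  have h2 : ‖a - gradient u x‖ ≤ ‖gradient u x - x‖ + ‖a - x‖ := by
    have : a - gradient u x = (a - x) - (gradient u x - x) := by abel
    rw [this, add_comm]
    exact norm_sub_le _ _
  have h3 := hu.1.2 x hx
  nlinarith [norm_nonneg (a - gradient u x), sq_nonneg (‖gradient u x - x‖ - ‖a - x‖)]

/-- The maximum minus `u` is nonnegative and vanishes at `x`, so its derivative there is zero. This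
also covers the contact set `u = p`, which need not be shown to be null. -/
theorem gradient_max_of_le {p : EuclideanSpace ℝ (Fin n) → ℝ} {x : EuclideanSpace ℝ (Fin n)}
    (hu : DifferentiableAt ℝ u x) (hv : DifferentiableAt ℝ (fun y => max (u y) (p y)) x)
    (h : p x ≤ u x) : gradient (fun y => max (u y) (p y)) x = gradient u x := by
  have hmin : IsLocalMin (fun y => max (u y) (p y) - u y) x := by
    refine Eventually.of_forall fun y => ?_
    simp only [max_eq_left h, sub_self]
    exact sub_nonneg.2 (le_max_left _ _)
  have h0 := hmin.hasFDerivAt_eq_zero (hv.hasFDerivAt.sub hu.hasFDerivAt)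
  rw [gradient, gradient, sub_eq_zero.1 h0]

/-- Comparison of a minimizer with its maximum with an affine function. -/
theorem IsMinimizer.half_setIntegral_norm_gradient_sq_le (hXo : IsOpen X)
    (hXb : Bornology.IsBounded X) (hu : IsMinimizer X u) (b : ℝ) (g : EuclideanSpace ℝ (Fin n))
    {w : EuclideanSpace ℝ (Fin n) → ℝ} (hw : w = fun x => b + inner ℝ g x - u x) {H : ℝ}
    (hH : ∀ x ∈ X, w x ≤ H) :
    IntegrableOn (fun x => ‖gradient w x‖ ^ 2) {x ∈ X | 0 < w x} volume ∧
    (∀ a, IntegrableOn (fun x => inner ℝ (gradient w x) (a - x)) {x ∈ X | 0 < w x} volume) ∧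
    1 / 2 * ∫ x in {x ∈ X | 0 < w x}, ‖gradient w x‖ ^ 2 ≤
      (∫ x in {x ∈ X | 0 < w x}, w x) +
        ∫ x in {x ∈ X | 0 < w x}, inner ℝ (gradient w x) (g - x) := by
  have hwconc : ConcaveOn ℝ X w := hw ▸ concaveOn_affine_sub hu.1.1 b g
  set S := {x ∈ X | 0 < w x} with hSdef
  have hSX : S ⊆ X := fun x hx => hx.1
  have hSo : IsOpen S := isOpen_setOf_pos hXo hwconc
  have hSm := hSo.measurableSet
  have hud : ∀ᵐ x, x ∈ X → DifferentiableAt ℝ u x := convexOn_ae_differentiableAt hXo hu.1.1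
  have hgw : ∀ {x}, DifferentiableAt ℝ u x → gradient w x = g - gradient u x := fun hd => by
    rw [hw]
    exact (hasGradientAt_affine_sub b g hd).gradient
  have hi1 : IntegrableOn (fun x => ‖gradient w x‖ ^ 2) S volume := by
    refine ((hu.integrableOn_norm_gradient_sub_sq hXo hXb g).mono_set hSX).congr ?_
    filter_upwards [ae_restrict_mem hSm, ae_restrict_of_ae hud] with x hx hd
    rw [hgw (hd hx.1)]
  have hi2 : ∀ a, IntegrableOn (fun x => inner ℝ (gradient w x) (a - x)) S volume := by
    intro a
    have hc : IntegrableOn (fun x => ‖a - x‖ ^ 2) S volume :=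
      ((by fun_prop : Continuous fun x : EuclideanSpace ℝ (Fin n) =>
        ‖a - x‖ ^ 2).locallyIntegrable.integrableOn_isCompact
        hXb.isCompact_closure).mono_set (hSX.trans subset_closure)
    refine (hi1.add hc).mono' ((measurable_gradient w).inner
      (measurable_const.sub measurable_id)).aestronglyMeasurable (ae_of_all _ fun x => ?_)
    have h1 := abs_real_inner_le_norm (gradient w x) (a - x)
    simp only [Pi.add_apply, Real.norm_eq_abs]
    nlinarith [sq_nonneg (‖gradient w x‖ - ‖a - x‖), sq_nonneg (‖gradient w x‖ + ‖a - x‖)]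
  have hi3 : IntegrableOn w S volume :=
    integrableOn_of_mem_Icc hSm (hXb.subset hSX) ((hwconc.continuousOn hXo).mono hSX)
      fun x hx => ⟨hx.2.le, hH x hx.1⟩
  refine ⟨hi1, hi2, ?_⟩
  -- On `S`, `D` is the change of the integrand when `u` is replaced by `max u p`: expand the
  -- completed square with `Du - x = (g - x) - Dw`.
  set D : EuclideanSpace ℝ (Fin n) → ℝ :=
    fun x => w x + inner ℝ (gradient w x) (g - x) - 1 / 2 * ‖gradient w x‖ ^ 2 with hD
  have hi4 : IntegrableOn (fun x => w x + inner ℝ (gradient w x) (g - x)) S volume :=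
    hi3.add (hi2 g)
  have hDint : IntegrableOn D S volume := hi4.sub (hi1.const_mul _)
  set p : EuclideanSpace ℝ (Fin n) → ℝ := fun x => b + inner ℝ g x with hp
  set v : EuclideanSpace ℝ (Fin n) → ℝ := fun x => max (u x) (p x) with hv
  have hvadm : v ∈ admissible X :=
    ⟨hu.1.1.sup (convexOn_affine hu.1.1.1 b g), fun x hx => (hu.1.2 x hx).trans (le_max_left _ _)⟩
  have hvd : ∀ᵐ x, x ∈ X → DifferentiableAt ℝ v x := convexOn_ae_differentiableAt hXo hvadm.1
  have hwp : ∀ x, w x = p x - u x := fun x => by rw [hw]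
  have hae : (fun x => integrand u x + S.indicator D x) =ᵐ[volume.restrict X] integrand v := by
    filter_upwards [ae_restrict_mem hXo.measurableSet, ae_restrict_of_ae hud,
      ae_restrict_of_ae hvd] with x hx hd hd'
    by_cases hxS : x ∈ S
    · have hev : v =ᶠ[𝓝 x] p := by
        filter_upwards [hSo.mem_nhds hxS] with y hy
        exact max_eq_right (by linarith [hy.2, hwp y])
      have hgv : gradient v x = g := by
        rw [hev.gradient_eq]
        exact (hasGradientAt_affine b g x).gradient
      have hgu : gradient w x = g - gradient u x := hgw (hd hx)
      rw [indicator_of_mem hxS, integrand_eq, integrand_eq, hgv, hev.self_of_nhds]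
      simp only [hD]
      have h1 : gradient u x - x = (g - x) - gradient w x := by rw [hgu]; abel
      rw [h1, norm_sub_sq_real, hwp x, real_inner_comm]
      ring
    · have hle : p x ≤ u x := by
        have : ¬ 0 < w x := fun h => hxS ⟨hx, h⟩
        linarith [hwp x]
      rw [indicator_of_notMem hxS, add_zero, integrand, integrand,
        gradient_max_of_le (hd hx) (hd' hx) hle]
      simp only [hv, max_eq_left hle]
  have hui := hu.integrableOn_integrand
  have hindX : IntegrableOn (S.indicator D) X volume :=
    ((integrable_indicator_iff hSm).2 hDint).integrableOn
  have hvi : IntegrableOn (integrand v) X volume := (hui.add hindX).congr hae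
  have hle := hu.2 v hvadm
  rw [Phi, Phi, if_pos hui, if_pos hvi, EReal.coe_le_coe_iff, ← integral_congr_ae hae,
    integral_add hui hindX, setIntegral_indicator hSm, inter_eq_right.2 hSX] at hle
  have h0 : 0 ≤ ∫ x in S, D x := by linarith
  simp only [hD] at h0
  rw [integral_sub hi4 (hi1.const_mul _), integral_add hi3 (hi2 g),
    integral_const_mul] at h0
  linarith

/-- Energy estimate for a minimizer below an affine function. -/
theorem IsMinimizer.energy_le (hXo : IsOpen X)
    (hXb : Bornology.IsBounded X) (hu : IsMinimizer X u) (b : ℝ) (g : EuclideanSpace ℝ (Fin n))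
    {w : EuclideanSpace ℝ (Fin n) → ℝ} (hw : w = fun x => b + inner ℝ g x - u x) {H M δ : ℝ}
    (hH : ∀ x ∈ X, w x ≤ H) {x₀ : EuclideanSpace ℝ (Fin n)} (hδ : 0 < δ)
    (hball : Metric.closedBall x₀ δ ⊆ X) (hw₀ : 0 ≤ w x₀) (hM : ‖g - x₀‖ ≤ M) :
    1 / 2 * ∫ x in {x ∈ X | 0 < w x}, ‖gradient w x‖ ^ 2 ≤
      (1 + (1 + M / δ) * n + M / δ) * H * volume.real {x ∈ X | 0 < w x} := by
  obtain ⟨hi1, hi2, hE⟩ := hu.half_setIntegral_norm_gradient_sq_le hXo hXb b g hw hH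
  have hwconc : ConcaveOn ℝ X w := hw ▸ concaveOn_affine_sub hu.1.1 b g
  have hx₀ : x₀ ∈ X := hball (Metric.mem_closedBall_self hδ.le)
  have hM0 : 0 ≤ M := (norm_nonneg _).trans hM
  set lam := M / δ with hlam
  have hlam0 : 0 ≤ lam := by positivity
  -- The slope `g` need not lie in `X`, but `c = (g + lam • x₀) / (1 + lam)` lies in the ball about
  -- `x₀`, so the contraction inequality applies at `c`. The remainder `-lam • (x₀ - x)` is
  -- controlled by the tangent plane, using `w x₀ ≥ 0`.
  set c := x₀ + (1 + lam)⁻¹ • (g - x₀) with hc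
  have hcX : c ∈ X := by
    apply hball
    rw [Metric.mem_closedBall, dist_eq_norm, hc, add_sub_cancel_left, norm_smul, norm_inv,
      Real.norm_of_nonneg (by positivity), inv_mul_le_iff₀ (by positivity)]
    have : lam * δ = M := div_mul_cancel₀ _ hδ.ne'
    nlinarith
  have hHom := setIntegral_inner_gradient_le hXo hXb hwconc hH hcX (hi2 c)
  rw [finrank_euclideanSpace_fin] at hHom
  set S := {x ∈ X | 0 < w x} with hSdef
  have hSX : S ⊆ X := fun x hx => hx.1
  have hSo : IsOpen S := isOpen_setOf_pos hXo hwconc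
  have hSm := hSo.measurableSet
  have hSfin : volume S ≠ ⊤ := (hXb.subset hSX).measure_lt_top.ne
  have hi3 : IntegrableOn w S volume :=
    integrableOn_of_mem_Icc hSm (hXb.subset hSX) ((hwconc.continuousOn hXo).mono hSX)
      fun x hx => ⟨hx.2.le, hH x hx.1⟩
  have hwS : ∫ x in S, w x ≤ H * volume.real S := by
    have := setIntegral_mono_on hi3 (integrableOn_const hSfin (C := H)) hSm
      fun x hx => hH x hx.1
    rwa [setIntegral_const, smul_eq_mul, mul_comm] at this
  have hconst : IntegrableOn (fun _ : EuclideanSpace ℝ (Fin n) => lam * H) S volume :=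
    integrableOn_const hSfin
  have hsplit : ∫ x in S, inner ℝ (gradient w x) (g - x) ≤
      (1 + lam) * (∫ x in S, inner ℝ (gradient w x) (c - x)) + lam * H * volume.real S := by
    rw [← integral_const_mul, mul_comm (lam * H), ← smul_eq_mul (volume.real S), ← setIntegral_const,
      ← integral_add ((hi2 c).const_mul _) hconst]
    refine setIntegral_mono_ae_restrict (hi2 g) (((hi2 c).const_mul _).add hconst) ?_
    filter_upwards [ae_restrict_mem hSm,
      ae_restrict_of_ae (concaveOn_ae_differentiableAt (μ := volume) hXo hwconc)] with x hx hd
    have h1 := concaveOn_sub_le_inner_gradient hwconc hx.1 hx₀ (hd hx.1)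
    have e : g - x = (1 + lam) • (c - x) - lam • (x₀ - x) := by
      have : (1 + lam) • (c - x) = (1 + lam) • (x₀ - x) + (g - x₀) := by
        have hs : c - x = (x₀ - x) + (1 + lam)⁻¹ • (g - x₀) := by rw [hc]; abel
        rw [hs, smul_add, smul_smul, mul_inv_cancel₀ (by positivity), one_smul]
      rw [this]
      module
    rw [e, inner_sub_right, real_inner_smul_right, real_inner_smul_right]
    have h2 := mul_le_mul_of_nonneg_left h1 hlam0
    have h3 := mul_le_mul_of_nonneg_left (hH x hx.1) hlam0
    have h4 := mul_nonneg hlam0 hw₀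
    linarith
  have hn : (0 : ℝ) ≤ n := by positivity
  have h5 := mul_le_mul_of_nonneg_left hHom (by positivity : 0 ≤ 1 + lam)
  have h6 := mul_le_mul_of_nonneg_left hwS (by positivity : 0 ≤ (1 + lam) * n)
  linarith

end Energy

/-! ### Confinement of the positivity set to a slab. -/

section Slab

variable {E : Type*} [NormedAddCommGroup E] [InnerProductSpace ℝ E] {X : Set E} {F : E → ℝ}

/-- If a concave function attains its minimum over a ball at a boundary point `x₁`, then it is
no larger beyond the tangent hyperplane to the ball at `x₁`. -/
theorem concaveOn_le_of_inner_gt (hF : ConcaveOn ℝ X F) {x₀ x₁ : E}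
    (hball : Metric.closedBall x₀ ‖x₁ - x₀‖ ⊆ X)
    (hmin : ∀ x ∈ Metric.closedBall x₀ ‖x₁ - x₀‖, F x₁ ≤ F x) {x : E} (hx : x ∈ X)
    (hs : ‖x₁ - x₀‖ ^ 2 < inner ℝ (x₁ - x₀) (x - x₀)) : F x ≤ F x₁ := by
  by_contra! hlt
  set e := x₁ - x₀ with he
  -- Prolonging the segment from `x` through `x₁` by this `t` stays in the ball. There `F` is at
  -- least `F x₁`, so `F x > F x₁` would contradict concavity at `x₁`.
  set t := 2 * (inner ℝ e (x - x₀) - ‖e‖ ^ 2) / (‖x₁ - x‖ ^ 2 + 1) with ht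
  have ht0 : 0 < t := div_pos (by linarith) (by positivity)
  have hy : x₁ + t • (x₁ - x) ∈ Metric.closedBall x₀ ‖e‖ := by
    rw [Metric.mem_closedBall, dist_eq_norm]
    refine le_of_sq_le_sq ?_ (norm_nonneg _)
    have h1 : x₁ + t • (x₁ - x) - x₀ = e + t • (x₁ - x) := by rw [he]; abel
    have h2 : inner ℝ e (x₁ - x) = ‖e‖ ^ 2 - inner ℝ e (x - x₀) := by
      rw [← real_inner_self_eq_norm_sq, ← inner_sub_right, he]
      congr 1
      abel
    rw [h1, norm_add_sq_real, real_inner_smul_right, h2, norm_smul, mul_pow, Real.norm_of_nonneg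
      ht0.le]
    have h3 : t * (‖x₁ - x‖ ^ 2 + 1) = 2 * (inner ℝ e (x - x₀) - ‖e‖ ^ 2) :=
      div_mul_cancel₀ _ (by positivity)
    nlinarith [mul_pos ht0 ht0]
  have hc := hF.2 (hball hy) hx (by positivity : 0 ≤ (1 + t)⁻¹)
    (by positivity : 0 ≤ (1 + t)⁻¹ * t) (by field_simp)
  have e1 : (1 + t)⁻¹ • (x₁ + t • (x₁ - x)) + ((1 + t)⁻¹ * t) • x = x₁ := by
    rw [mul_smul, ← smul_add]
    have : x₁ + t • (x₁ - x) + t • x = (1 + t) • x₁ := by module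
    rw [this, inv_smul_smul₀ (by positivity)]
  rw [e1, smul_eq_mul, smul_eq_mul, mul_assoc, ← mul_add, inv_mul_le_iff₀ (by positivity)] at hc
  nlinarith [hmin _ hy]

/-- Shrinking `x` towards `x₀` by `θ = 2 / (s + 1)` still gives a point with coordinate `2s / (s +
1) > 1`, where `F ≤ F x₁`. Concavity along the segment from `x₀`, where `F = 0`, scales this up to
the bound at `x`. -/
theorem concaveOn_tilt_nonpos (hF : ConcaveOn ℝ X F) {x₀ x₁ : E} (hx₀ : x₀ ∈ X)
    (hne : x₁ ≠ x₀) (hball : Metric.closedBall x₀ ‖x₁ - x₀‖ ⊆ X)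
    (hmin : ∀ x ∈ Metric.closedBall x₀ ‖x₁ - x₀‖, F x₁ ≤ F x) (h₀ : F x₀ = 0) {x : E} (hx : x ∈ X)
    (hs : 1 < inner ℝ (x₁ - x₀) (x - x₀) / ‖x₁ - x₀‖ ^ 2) :
    -F x₁ / 2 * (1 + inner ℝ (x₁ - x₀) (x - x₀) / ‖x₁ - x₀‖ ^ 2) + F x ≤ 0 := by
  have hr : 0 < ‖x₁ - x₀‖ ^ 2 := by
    have := norm_pos_iff.2 (sub_ne_zero.2 hne)
    positivity
  set s := inner ℝ (x₁ - x₀) (x - x₀) / ‖x₁ - x₀‖ ^ 2 with hsd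
  have hsr : inner ℝ (x₁ - x₀) (x - x₀) = s * ‖x₁ - x₀‖ ^ 2 := (div_mul_cancel₀ _ hr.ne').symm
  set θ := 2 / (s + 1) with hθ
  have hθs : θ * (s + 1) = 2 := div_mul_cancel₀ _ (by linarith)
  have hθ0 : 0 < θ := div_pos two_pos (by linarith)
  have hθ1 : θ ≤ 1 := (div_le_one (by linarith)).2 (by linarith)
  have hz : x₀ + θ • (x - x₀) ∈ X := hF.1.add_smul_sub_mem hx₀ hx ⟨hθ0.le, hθ1⟩
  have h1 := concaveOn_le_of_inner_gt hF hball hmin hz (by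
    rw [add_sub_cancel_left, real_inner_smul_right, hsr, ← mul_assoc]
    refine lt_mul_of_one_lt_left hr ?_
    have : θ < 1 := (div_lt_one (by linarith)).2 (by linarith)
    nlinarith)
  have h2 := concaveOn_le_slope hF hx₀ hx hθ0 hθ1
  rw [le_div_iff₀ hθ0, h₀, sub_zero, sub_zero] at h2
  have h3 := mul_le_mul_of_nonneg_right (h2.trans h1) (by linarith : 0 ≤ s + 1)
  rw [mul_assoc, hθs] at h3
  linarith

end Slab

/-! ### Quadratic growth and regularity of the gradient. -/

section Quadratic

variable {n : ℕ} {X : Set (EuclideanSpace ℝ (Fin n))} {u : EuclideanSpace ℝ (Fin n) → ℝ}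

/-- The height of a minimizer over a supporting affine function, maximized over a ball, grows at
most quadratically in the radius. -/
theorem IsMinimizer.height_le (hXo : IsOpen X) (hXb : Bornology.IsBounded X) (hu : IsMinimizer X u)
    {x₀ x₁ q : EuclideanSpace ℝ (Fin n)} {δ M H : ℝ} (hδ : 0 < δ)
    (hball : Metric.closedBall x₀ δ ⊆ X) (hq : ∀ x ∈ X, u x₀ + inner ℝ q (x - x₀) ≤ u x)
    (hr : 4 * ‖x₁ - x₀‖ ≤ δ) (hH : H = u x₁ - u x₀ - inner ℝ q (x₁ - x₀)) (hH0 : 0 < H)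
    (hmax : ∀ x ∈ Metric.closedBall x₀ ‖x₁ - x₀‖, u x - u x₀ - inner ℝ q (x - x₀) ≤ H)
    (hM : ‖q‖ + H / (2 * ‖x₁ - x₀‖) + ‖x₀‖ ≤ M) :
    H ≤ 128 * 4 ^ n * (1 + (1 + M / δ) * n + M / δ) * ‖x₁ - x₀‖ ^ 2 := by
  have hx₀ : x₀ ∈ X := hball (Metric.mem_closedBall_self hδ.le)
  have hne : x₁ ≠ x₀ := by
    rintro rfl
    simp at hH
    linarith
  set e := x₁ - x₀ with he
  set r := ‖e‖ with hrdef
  have hr0 : 0 < r := norm_pos_iff.2 (sub_ne_zero.2 hne)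
  have hballr : Metric.closedBall x₀ r ⊆ X :=
    (Metric.closedBall_subset_closedBall (by linarith)).trans hball
  set F : EuclideanSpace ℝ (Fin n) → ℝ := fun x => (u x₀ - inner ℝ q x₀) + inner ℝ q x - u x with hF
  have hFx : ∀ x, F x = -(u x - u x₀ - inner ℝ q (x - x₀)) := fun x => by
    simp only [hF, inner_sub_right]
    ring
  have hFc : ConcaveOn ℝ X F := concaveOn_affine_sub hu.1.1 _ q
  have hF₁ : F x₁ = -H := by rw [hFx, hH]
  have hF₀ : F x₀ = 0 := by rw [hFx]; simp
  have hFnonpos : ∀ x ∈ X, F x ≤ 0 := fun x hx => by rw [hFx]; linarith [hq x hx]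
  have hFmin : ∀ x ∈ Metric.closedBall x₀ r, F x₁ ≤ F x := fun x hx => by
    rw [hF₁, hFx]; linarith [hmax x hx]
  set s : EuclideanSpace ℝ (Fin n) → ℝ := fun x => inner ℝ e (x - x₀) / r ^ 2 with hs
  set g := q + (H / (2 * r ^ 2)) • e with hg
  set b := u x₀ - inner ℝ g x₀ + H / 2 with hb
  obtain ⟨w, hw⟩ : ∃ w : EuclideanSpace ℝ (Fin n) → ℝ, w = fun x => b + inner ℝ g x - u x :=
    ⟨_, rfl⟩
  have hwF : ∀ x, w x = H / 2 * (1 + s x) + F x := fun x => by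
    rw [hw]
    simp only [hb, hg, hF, hs, inner_add_left, real_inner_smul_left, inner_sub_right]
    field_simp
    ring
  have hout : ∀ x ∈ X, 1 < s x → w x ≤ 0 := fun x hx hsx => by
    have := concaveOn_tilt_nonpos hFc hx₀ hne hballr hFmin hF₀ hx hsx
    rwa [hF₁, neg_neg, ← hwF] at this
  have hwH : ∀ x ∈ X, w x ≤ H := fun x hx => by
    by_cases h : 1 < s x
    · exact (hout x hx h).trans hH0.le
    · rw [hwF]
      nlinarith [hFnonpos x hx]
  have hlow : ∀ x ∈ X, 0 < w x → -1 < s x := fun x hx h => by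
    rw [hwF] at h
    by_contra! h'
    nlinarith [hFnonpos x hx]
  have hw₀ : w x₀ = H / 2 := by
    rw [hwF, hF₀]
    simp [hs]
  have hgM : ‖g - x₀‖ ≤ M := by
    refine le_trans (norm_sub_le _ _) (le_trans (add_le_add_left (norm_add_le _ _) _) ?_)
    have : ‖(H / (2 * r ^ 2)) • e‖ = H / (2 * r) := by
      rw [norm_smul, Real.norm_of_nonneg (by positivity), ← hrdef]
      field_simp
    rw [this]
    exact hM
  have hM0 : 0 ≤ M := (norm_nonneg _).trans hgM
  have hen := hu.energy_le hXo hXb b g hw hwH hδ hball (by rw [hw₀]; positivity) hgM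
  obtain ⟨hi1, hi2, -⟩ := hu.half_setIntegral_norm_gradient_sq_le hXo hXb b g hw hwH
  have hwc : ConcaveOn ℝ X w := hw ▸ concaveOn_affine_sub hu.1.1 b g
  set A := 1 + (1 + M / δ) * n + M / δ with hA
  have hA0 : 0 < A := by positivity
  -- Halving towards `x₀`, where `w = H/2`, gives `w ≥ H/4` and `s > -1/2`. A shift by `2e` raises
  -- `s` by 2, past the slab.
  set S' := AffineMap.homothety x₀ (1 / 2 : ℝ) '' {x ∈ X | 0 < w x} with hS'
  set S := {x ∈ X | 0 < w x} with hSdef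
  have hSX : S ⊆ X := fun x hx => hx.1
  have hSo : IsOpen S := isOpen_setOf_pos hXo hwc
  have hSfin : volume S ≠ ⊤ := (hXb.subset hSX).measure_lt_top.ne
  have hx₀S : x₀ ∈ S := ⟨hx₀, by rw [hw₀]; positivity⟩
  have hhom : ∀ z, AffineMap.homothety x₀ (1 / 2 : ℝ) z = (1 / 2 : ℝ) • z + (1 / 2 : ℝ) • x₀ := by
    intro z
    rw [AffineMap.homothety_apply, vsub_eq_sub, vadd_eq_add]
    module
  have hS'w : ∀ x ∈ S', x ∈ X ∧ H / 4 ≤ w x ∧ -(1 / 2) < s x := by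
    rintro _ ⟨z, hz, rfl⟩
    rw [hhom]
    refine ⟨hwc.1 hz.1 hx₀ (by norm_num) (by norm_num) (by norm_num), ?_, ?_⟩
    · have := hwc.2 hz.1 hx₀ (by norm_num : (0 : ℝ) ≤ 1 / 2) (by norm_num : (0 : ℝ) ≤ 1 / 2)
        (by norm_num)
      rw [smul_eq_mul, smul_eq_mul, hw₀] at this
      linarith [hz.2]
    · have h1 := hlow z hz.1 hz.2
      have h2 : (1 / 2 : ℝ) • z + (1 / 2 : ℝ) • x₀ - x₀ = (1 / 2 : ℝ) • (z - x₀) := by module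
      simp only [hs] at h1 ⊢
      rw [h2, real_inner_smul_right, mul_div_assoc]
      linarith
  -- The shifted points are midpoints of a point of `closure X` and a point within `4r ≤ δ` of `x₀`,
  -- hence interior to `X`.
  obtain ⟨K, hKc, hKX, hK⟩ : ∃ K, IsCompact K ∧ K ⊆ X ∧
      ∀ x ∈ S', ∀ t ∈ Icc (0 : ℝ) 1, x + t • (2 : ℝ) • e ∈ K := by
    refine ⟨(fun p : EuclideanSpace ℝ (Fin n) × EuclideanSpace ℝ (Fin n) =>
      (1 / 2 : ℝ) • p.1 + (1 / 2 : ℝ) • x₀ + p.2) '' (closure X ×ˢ Metric.closedBall 0 (2 * r)),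
      (hXb.isCompact_closure.prod (isCompact_closedBall _ _)).image (by fun_prop), ?_, ?_⟩
    · rintro _ ⟨⟨z, v⟩, ⟨hz, hv⟩, rfl⟩
      have hv' : ‖v‖ ≤ 2 * r := by simpa using hv
      have h1 : x₀ + (2 : ℝ) • v ∈ interior X := by
        rw [hXo.interior_eq]
        apply hball
        rw [Metric.mem_closedBall, dist_eq_norm, add_sub_cancel_left, norm_smul, Real.norm_two]
        linarith
      have h2 := hu.1.1.1.combo_closure_interior_mem_interior hz h1
        (by norm_num : (0 : ℝ) ≤ 1 / 2) (by norm_num : (0 : ℝ) < 1 / 2) (by norm_num)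
      rw [hXo.interior_eq] at h2
      convert h2 using 1
      module
    · rintro _ ⟨z, hz, rfl⟩ t ht
      refine ⟨(z, t • (2 : ℝ) • e), ⟨subset_closure hz.1, ?_⟩, by simp only [hhom]⟩
      rw [mem_closedBall_zero_iff, norm_smul, norm_smul, Real.norm_two, Real.norm_of_nonneg ht.1]
      exact mul_le_of_le_one_left (by positivity) ht.2
  have hS'm : MeasurableSet S' :=
    (AffineMap.homothety_isOpenMap x₀ (1 / 2 : ℝ) (by norm_num) S hSo).measurableSet
  have hie : IntegrableOn (fun x => inner ℝ (gradient w x) ((2 : ℝ) • e)) S volume := by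
    refine ((hi2 ((2 : ℝ) • e)).sub (hi2 0)).congr (ae_of_all _ fun x => ?_)
    simp only [Pi.sub_apply]
    rw [← inner_sub_right]
    congr 1
    abel
  have htr := mul_measureReal_le_setIntegral_abs_inner_gradient hXo hXb hwc (a := H / 4) hKc hKX
    hS'm (fun x hx => ⟨(hS'w x hx).1, by linarith [(hS'w x hx).2.1]⟩) hK (fun x hx => by
      have hX : x + (2 : ℝ) • e ∈ X := by
        have := hK x hx 1 ⟨zero_le_one, le_rfl⟩
        rw [one_smul] at this
        exact hKX this
      refine not_lt.2 (hout _ hX ?_)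
      have h1 := (hS'w x hx).2.2
      have h2 : x + (2 : ℝ) • e - x₀ = (x - x₀) + (2 : ℝ) • e := by abel
      simp only [hs] at h1 ⊢
      rw [h2, inner_add_right, real_inner_smul_right, real_inner_self_eq_norm_sq, ← hrdef, add_div,
        mul_div_cancel_right₀ _ (by positivity)]
      linarith) (fun x hx => (hS'w x hx).2.1) hie
  have hvol : volume.real S' = (1 / 2) ^ n * volume.real S := by
    rw [Measure.real, hS', Measure.addHaar_image_homothety, ENNReal.toReal_mul,
      finrank_euclideanSpace_fin, ENNReal.toReal_ofReal (abs_nonneg _), abs_of_nonneg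
      (by positivity), Measure.real]
  have hSpos : 0 < volume.real S :=
    ENNReal.toReal_pos (hSo.measure_pos volume ⟨x₀, hx₀S⟩).ne' hSfin
  set c : ℝ := (1 / 2) ^ n with hc
  have hc0 : 0 < c := by positivity
  -- With this weight the energy term absorbs exactly half of the lower bound `H/4 * c * |S|`.
  set α := c / (16 * A) with hα
  have hα0 : 0 < α := by positivity
  have hamgm : ∫ x in S, |inner ℝ (gradient w x) ((2 : ℝ) • e)| ≤
      α * (∫ x in S, ‖gradient w x‖ ^ 2) + r ^ 2 / α * volume.real S := by
    rw [mul_comm (r ^ 2 / α), ← smul_eq_mul (volume.real S), ← setIntegral_const,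
      ← integral_const_mul, ← integral_add (hi1.const_mul _) (integrableOn_const hSfin)]
    refine integral_mono hie.abs ((hi1.const_mul _).add (integrableOn_const hSfin)) fun x => ?_
    beta_reduce
    refine (abs_real_inner_le_norm _ _).trans ?_
    rw [norm_smul, Real.norm_two, ← hrdef]
    have h1 : α * ‖gradient w x‖ ^ 2 + r ^ 2 / α - ‖gradient w x‖ * (2 * r)
        = (α * ‖gradient w x‖ - r) ^ 2 / α := by
      field_simp
      ring
    have h2 : 0 ≤ (α * ‖gradient w x‖ - r) ^ 2 / α := by positivity
    linarith
  rw [hvol] at htr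
  have h1 : α * (∫ x in S, ‖gradient w x‖ ^ 2) ≤ c / 8 * H * volume.real S := by
    have h2 := mul_le_mul_of_nonneg_left hen (by positivity : 0 ≤ 2 * α)
    have h3 : 2 * α * (A * H * volume.real S) = c / 8 * H * volume.real S := by
      rw [hα]
      field_simp
      norm_num
    linarith
  have h2 : c / 8 * H ≤ r ^ 2 / α := by
    refine le_of_mul_le_mul_right ?_ hSpos
    linarith
  have h3 : r ^ 2 / α = c / 8 * (128 * 4 ^ n * A * r ^ 2) := by
    have h4 : c ^ 2 * 4 ^ n = 1 := by
      rw [hc, ← pow_mul, mul_comm n 2, pow_mul, ← mul_pow]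
      norm_num
    have h5 : r ^ 2 / α = 16 * A * r ^ 2 / c := by
      rw [hα]
      field_simp
    rw [h5, div_eq_iff hc0.ne']
    linear_combination (-16 * A * r ^ 2) * h4
  rw [h3] at h2
  exact le_of_mul_le_mul_left h2 (by positivity)

/-- Uniform bounds for the subgradients of a minimizer and for its deviation from the supporting
affine functions, on compact sets. -/
theorem IsMinimizer.exists_quadratic_bound (hXo : IsOpen X) (hXb : Bornology.IsBounded X)
    (hu : IsMinimizer X u) {K : Set (EuclideanSpace ℝ (Fin n))} (hK : IsCompact K) (hKX : K ⊆ X) :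
    ∃ δ > 0, ∃ L ≥ 0, ∃ C ≥ 0, ∀ x₀ ∈ K, ∀ q, (∀ x ∈ X, u x₀ + inner ℝ q (x - x₀) ≤ u x) →
      ‖q‖ ≤ L ∧ ∀ x, ‖x - x₀‖ ≤ δ →
        x ∈ X ∧ u x - u x₀ - inner ℝ q (x - x₀) ≤ C * ‖x - x₀‖ ^ 2 := by
  obtain ⟨δ, hδ, hδX⟩ := hK.exists_cthickening_subset_open hXo hKX
  have huc : ContinuousOn u X := hu.1.1.continuousOn hXo
  obtain ⟨B, hB0, hB⟩ : ∃ B ≥ 0, ∀ x ∈ Metric.cthickening δ K, u x ≤ B := by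
    obtain ⟨B, hB⟩ := (hK.cthickening (r := δ)).bddAbove_image (huc.mono hδX)
    exact ⟨max B 0, le_max_right _ _, fun x hx => le_max_of_le_left (hB ⟨x, hx, rfl⟩)⟩
  obtain ⟨R, hR⟩ := hXb.exists_norm_le
  -- The three terms bound `‖q‖`, the tilt `H / (2r)` and `‖x₀‖`.
  set M := B / δ + B / δ + |R| with hM
  have hM0 : 0 ≤ M := by positivity
  refine ⟨δ / 4, by positivity, B / δ, by positivity,
    128 * 4 ^ n * (1 + (1 + M / δ) * n + M / δ), by positivity, fun x₀ hx₀ q hq => ?_⟩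
  have hballK : Metric.closedBall x₀ δ ⊆ Metric.cthickening δ K :=
    Metric.closedBall_subset_cthickening hx₀ δ
  have hball := hballK.trans hδX
  have hx₀X := hKX hx₀
  have hdir : ∀ v : EuclideanSpace ℝ (Fin n), v ≠ 0 →
      x₀ + (δ / ‖v‖) • v ∈ Metric.closedBall x₀ δ := fun v hv => by
    rw [Metric.mem_closedBall, dist_eq_norm, add_sub_cancel_left, norm_smul, norm_div, norm_norm,
      div_mul_cancel₀ _ (norm_ne_zero_iff.2 hv), Real.norm_of_nonneg hδ.le]
  have hqB : ‖q‖ ≤ B / δ := by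
    by_cases h0 : q = 0
    · rw [h0, norm_zero]; positivity
    have hz := hdir q h0
    have h1 := hq _ (hball hz)
    have h2 := hB _ (hballK hz)
    have hq0 := norm_pos_iff.2 h0
    rw [add_sub_cancel_left, real_inner_smul_right, real_inner_self_eq_norm_sq, sq, ← mul_assoc,
      div_mul_cancel₀ _ hq0.ne'] at h1
    rw [le_div_iff₀ hδ]
    linarith [hu.1.2 _ hx₀X]
  refine ⟨hqB, fun x hx => ?_⟩
  have hballx : Metric.closedBall x₀ ‖x - x₀‖ ⊆ Metric.closedBall x₀ δ :=
    Metric.closedBall_subset_closedBall (by linarith)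
  have hxm : x ∈ Metric.closedBall x₀ ‖x - x₀‖ := by
    rw [Metric.mem_closedBall, dist_eq_norm]
  refine ⟨hball (hballx hxm), ?_⟩
  have hfc : ContinuousOn (fun x => u x - u x₀ - inner ℝ q (x - x₀))
      (Metric.closedBall x₀ ‖x - x₀‖) :=
    ((huc.mono (hballx.trans hball)).sub continuousOn_const).sub (by fun_prop)
  -- The maximizer may be interior; `height_le` is then applied on the smaller ball of radius `‖x₁ -
  -- x₀‖`.
  obtain ⟨x₁, hx₁, hmax⟩ := (isCompact_closedBall x₀ ‖x - x₀‖).exists_isMaxOn ⟨x, hxm⟩ hfc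
  have hr₁ : ‖x₁ - x₀‖ ≤ ‖x - x₀‖ := by rwa [Metric.mem_closedBall, dist_eq_norm] at hx₁
  set H := u x₁ - u x₀ - inner ℝ q (x₁ - x₀) with hH
  have hxH : u x - u x₀ - inner ℝ q (x - x₀) ≤ H := hmax hxm
  refine hxH.trans ?_
  rcases le_or_gt H 0 with hH0 | hH0
  · exact hH0.trans (by positivity)
  have hne : x₁ - x₀ ≠ 0 := by
    intro h
    rw [hH, h, inner_zero_right, sub_eq_zero.1 h] at hH0
    simp at hH0
  have hr0 := norm_pos_iff.2 hne
  refine (hu.height_le hXo hXb (M := M) hδ hball hq (by linarith) hH hH0 (fun y hy =>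
    hmax (Metric.closedBall_subset_closedBall hr₁ hy)) ?_).trans (by gcongr)
  have hRx : ‖x₀‖ ≤ |R| := (hR x₀ hx₀X).trans (le_abs_self R)
  -- Convexity along the ray through `x₁` to distance `δ`, where the height is at most `2B`.
  have hHr : H / (2 * ‖x₁ - x₀‖) ≤ B / δ := by
    have hz := hdir _ hne
    have hsl := concaveOn_le_slope (concaveOn_affine_sub hu.1.1 (u x₀ - inner ℝ q x₀) q) hx₀X
      (hball hz) (t := ‖x₁ - x₀‖ / δ) (by positivity) ((div_le_one hδ).2 (by linarith))
    have e1 : x₀ + (‖x₁ - x₀‖ / δ) • (x₀ + (δ / ‖x₁ - x₀‖) • (x₁ - x₀) - x₀) = x₁ := by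
      rw [add_sub_cancel_left, smul_smul, div_mul_div_cancel₀ hδ.ne', div_self hr0.ne', one_smul,
        add_sub_cancel]
    rw [e1, le_div_iff₀ (by positivity)] at hsl
    have hz2 := hB _ (hballK hz)
    set z := x₀ + (δ / ‖x₁ - x₀‖) • (x₁ - x₀) with hzd
    have h1 : -(inner ℝ q (z - x₀)) ≤ B := by
      have h2 := neg_le_of_abs_le ((abs_real_inner_le_norm q (z - x₀)))
      have h3 : ‖z - x₀‖ ≤ δ := by rwa [Metric.mem_closedBall, dist_eq_norm] at hz
      have h4 : ‖q‖ * ‖z - x₀‖ ≤ B / δ * δ := mul_le_mul hqB h3 (norm_nonneg _) (by positivity)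
      rw [div_mul_cancel₀ _ hδ.ne'] at h4
      linarith
    have h5 : -(2 * B) ≤ (u x₀ - inner ℝ q x₀ + inner ℝ q z - u z) -
        (u x₀ - inner ℝ q x₀ + inner ℝ q x₀ - u x₀) := by
      rw [inner_sub_right] at h1
      linarith [hu.1.2 _ hx₀X]
    have h6 : (u x₀ - inner ℝ q x₀ + inner ℝ q x₁ - u x₁) -
        (u x₀ - inner ℝ q x₀ + inner ℝ q x₀ - u x₀) = -H := by
      rw [hH, inner_sub_right]
      ring
    rw [h6] at hsl
    have h7 := (mul_le_mul_of_nonneg_right h5 (by positivity : 0 ≤ ‖x₁ - x₀‖ / δ)).trans hsl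
    rw [div_le_iff₀ (by positivity)]
    have h8 : B / δ * (2 * ‖x₁ - x₀‖) = 2 * B * (‖x₁ - x₀‖ / δ) := by ring
    linarith
  rw [hM]
  linarith

theorem IsMinimizer.hasGradientAt_of_subgradient (hXo : IsOpen X) (hXb : Bornology.IsBounded X)
    (hu : IsMinimizer X u) {x₀ q : EuclideanSpace ℝ (Fin n)} (hx₀ : x₀ ∈ X)
    (hq : ∀ x ∈ X, u x₀ + inner ℝ q (x - x₀) ≤ u x) : HasGradientAt u q x₀ := by
  obtain ⟨δ, hδ, _, _, C, hC, h⟩ := hu.exists_quadratic_bound hXo hXb isCompact_singleton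
    (singleton_subset_iff.2 hx₀)
  have hb := (h x₀ rfl q hq).2
  rw [hasGradientAt_iff_isLittleO]
  have hO : (fun x => u x - u x₀ - inner ℝ q (x - x₀)) =O[𝓝 x₀] fun x => ‖x - x₀‖ ^ 2 := by
    refine Asymptotics.IsBigO.of_bound C ?_
    filter_upwards [Metric.closedBall_mem_nhds x₀ hδ] with x hx
    rw [Metric.mem_closedBall, dist_eq_norm] at hx
    obtain ⟨hxX, hx2⟩ := hb x hx
    rw [Real.norm_of_nonneg (by linarith [hq x hxX]), Real.norm_of_nonneg (by positivity)]
    exact hx2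
  exact hO.trans_isLittleO (Asymptotics.isLittleO_pow_sub_sub x₀ one_lt_two)

theorem IsMinimizer.differentiableAt_and_le (hXo : IsOpen X) (hXb : Bornology.IsBounded X)
    (hu : IsMinimizer X u) {x₀ : EuclideanSpace ℝ (Fin n)} (hx₀ : x₀ ∈ X) :
    DifferentiableAt ℝ u x₀ ∧ ∀ x ∈ X, u x₀ + inner ℝ (gradient u x₀) (x - x₀) ≤ u x := by
  obtain ⟨q, hq⟩ := exists_subgradient hXo hu.1.1 hx₀
  have h := hu.hasGradientAt_of_subgradient hXo hXb hx₀ hq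
  rw [h.gradient]
  exact ⟨h.differentiableAt, hq⟩

theorem IsMinimizer.exists_lipschitzOnWith_gradient (hXo : IsOpen X) (hXb : Bornology.IsBounded X)
    (hu : IsMinimizer X u) {K : Set (EuclideanSpace ℝ (Fin n))} (hK : IsCompact K) (hKX : K ⊆ X) :
    ∃ L : ℝ≥0, LipschitzOnWith L (gradient u) K := by
  obtain ⟨δ, hδ, L, hL, C, hC, h⟩ := hu.exists_quadratic_bound hXo hXb hK hKX
  refine ⟨(4 * C + 4 * L / δ).toNNReal, LipschitzOnWith.of_dist_le_mul fun y hy x hx => ?_⟩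
  rw [Real.coe_toNNReal _ (by positivity), dist_eq_norm, dist_eq_norm]
  obtain ⟨hLx, hbx⟩ := h x hx _ (hu.differentiableAt_and_le hXo hXb (hKX hx)).2
  have hLy := (h y hy _ (hu.differentiableAt_and_le hXo hXb (hKX hy)).2).1
  set g := gradient u y - gradient u x with hg
  by_cases hg0 : g = 0
  · rw [hg0, norm_zero]; positivity
  have hgpos := norm_pos_iff.2 hg0
  have hxy : y - x ≠ 0 := fun h => hg0 (by rw [hg, sub_eq_zero.1 h, sub_self])
  have hd := norm_pos_iff.2 hxy
  rcases le_or_gt (2 * ‖y - x‖) δ with hnear | hfar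
  -- Moving from `y` along the gradient difference: the support at `y` bounds `u z` below and the
  -- quadratic bound at `x` bounds it above, so `‖y - x‖ * ‖g‖ ≤ C * (2 * ‖y - x‖) ^ 2`.
  · set z := y + (‖y - x‖ / ‖g‖) • g with hz
    have hzy : z - y = (‖y - x‖ / ‖g‖) • g := add_sub_cancel_left _ _
    have hzx : ‖z - x‖ ≤ 2 * ‖y - x‖ := by
      have h1 : z - x = (z - y) + (y - x) := by abel
      rw [h1]
      refine (norm_add_le _ _).trans ?_
      rw [hzy, norm_smul, norm_div, norm_norm, norm_norm, div_mul_cancel₀ _ hgpos.ne']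
      linarith
    obtain ⟨hzX, h1⟩ := hbx z (hzx.trans hnear)
    have h2 := (hu.differentiableAt_and_le hXo hXb (hKX hy)).2 z hzX
    have h3 := (hu.differentiableAt_and_le hXo hXb (hKX hx)).2 y (hKX hy)
    have h4 : inner ℝ g (z - y) = ‖y - x‖ * ‖g‖ := by
      rw [hzy, real_inner_smul_right, real_inner_self_eq_norm_sq, sq, ← mul_assoc,
        div_mul_cancel₀ _ hgpos.ne']
    have h5 : inner ℝ (gradient u x) (z - x)
        = inner ℝ (gradient u x) (z - y) + inner ℝ (gradient u x) (y - x) := by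
      rw [← inner_add_right]
      congr 1
      abel
    rw [hg, inner_sub_left, ← hg] at h4
    have h6 : C * ‖z - x‖ ^ 2 ≤ C * (2 * ‖y - x‖) ^ 2 := by gcongr
    have h7 : ‖y - x‖ * ‖g‖ ≤ ‖y - x‖ * (4 * C * ‖y - x‖) := by linarith
    have h8 := le_of_mul_le_mul_left h7 hd
    have h9 : 0 ≤ 4 * L / δ * ‖y - x‖ := by positivity
    linarith
  · have h1 : ‖g‖ ≤ 2 * L := (norm_sub_le _ _).trans (by linarith)
    have h2 : 2 * L ≤ 4 * L / δ * ‖y - x‖ := by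
      rw [div_mul_eq_mul_div, le_div_iff₀ hδ]
      nlinarith
    have h3 : 0 ≤ 4 * C * ‖y - x‖ := by positivity
    linarith

theorem IsMinimizer.continuousOn_gradient (hXo : IsOpen X) (hXb : Bornology.IsBounded X)
    (hu : IsMinimizer X u) : ContinuousOn (gradient u) X := fun x hx => by
  obtain ⟨ε, hε, hεX⟩ := Metric.nhds_basis_closedBall.mem_iff.1 (hXo.mem_nhds hx)
  obtain ⟨L, hL⟩ := hu.exists_lipschitzOnWith_gradient hXo hXb (isCompact_closedBall x ε) hεX
  exact (hL.continuousOn.continuousAt (Metric.closedBall_mem_nhds x hε)).continuousWithinAt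

end Quadratic

end PrincipalAgent

theorem mainTheorem2 (n : ℕ) (X : Set (EuclideanSpace ℝ (Fin n)))
    (hX_open : IsOpen X) (hX_convex : Convex ℝ X) (hX_bounded : Bornology.IsBounded X)
    (u : EuclideanSpace ℝ (Fin n) → ℝ) (hu : PrincipalAgent.IsMinimizer X u) :
    PrincipalAgent.IsC11Loc X u := by
  refine ⟨?_, fun K hK hKX => ⟨?_, hu.exists_lipschitzOnWith_gradient hX_open hX_bounded hK hKX⟩⟩
  · rw [show (1 : WithTop ℕ∞) = 0 + 1 from (zero_add 1).symm,
      contDiffOn_succ_iff_fderiv_of_isOpen hX_open]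
    refine ⟨fun x hx => (hu.differentiableAt_and_le hX_open hX_bounded
      hx).1.differentiableWithinAt, by simp, contDiffOn_zero.2 ?_⟩
    rw [← toDual_comp_gradient]
    exact (InnerProductSpace.toDual ℝ _).continuous.comp_continuousOn
      (hu.continuousOn_gradient hX_open hX_bounded)
  · exact ((hu.1.1.locallyLipschitzOn hX_open).mono hKX).exists_lipschitzOnWith_of_compact hK
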